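/- **Setting.** Fix a finite set of parameters: parametric constants $P_c$, interpreted as real numbers, and parametric functions $P_f$ (with arities), interpreted as real functions. Terms are built from the parameters, rational numerals, variables and $+,\cdot,-$. An interpretation $\mathcal A$ assigns real values to the parameters. (A fixed real constant that is not rational is treated as a parametric constant.) A *parametric linear hybrid automaton* (PLHA) $S$ over variables $X=\{x_1,\dots,x_n\}$ has finitely many control modes and control switches and the following conditions. Mode invariants ${\sf Inv}_q$, initial conditions ${\sf Init}_q$ and guards ${\sf guard}_e$ are finite conjunctions of constraints $\sum_i a_i x_i \rhd f(t)$ with $\rhd\in\{\le,<,\ge,>\}$. Flow conditions are finite conjunctions of constraints $\sum_i b_i\dot x_i\le b$. Jump conditions are finite conjunctions of constraints $\sum_i (b_i x_i+c_i x_i')\rhd d(t)$. The coefficients and $b$ are closed terms (e.g. numerical or parametric constants), and $f,d$ are terms with at most the free variable $t$ (time). Each constraint may be relative to a closed time interval (one- or two-sided bounded by closed terms, or all of $\mathbb R$), i.e. it is imposed only at times in that interval. A *convex linear property* $\Phi$ is a finite conjunction of constraints $\sum_i a_i x_i\rhd f(t)$ of the same kind as the mode invariants. $\mathcal A$ *satisfies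 the convexity conditions of $S$* if in ${\sf Inv}_q$, ${\sf Init}_q$ and ${\sf guard}_e$ all upper bounds are concave and all lower bounds are convex functions of $t$, on the interval of the constraint. Time is non-negative. A *flow* of mode $q$ during $[t_0,t_1]$ is a function $x:\mathbb R\to\mathbb R^n$ which is continuous on $[t_0,t_1]$, satisfies ${\sf Inv}_q$ at all times in $[t_0,t_1]$, and is differentiable on $(t_0,t_1)$ with a derivative satisfying the flow condition there. A *jump* along a switch $e=(q,q')$ at time $t$ leads from a state $a$ satisfying ${\sf Inv}_q$ and ${\sf guard}_e$ to a state $a'$ satisfying ${\sf Inv}_{q'}$ such that $(a,a')$ satisfies ${\sf jump}_e$; after it time either continues from $t$ or restarts at $0$, as specified for the switch. $\Phi$ is an *invariant of $S$ w.r.t. $\mathcal A$* if, under $\mathcal A$, $\Phi$ holds in all initial states (at all times $t\ge 0$) and is preserved by all flows and all jumps. **Theorem.** There is an algorithm which computes, from a PLHA $S$ and a convex linear property $\Phi$ over $X$, both possibly with parameters, a finite set $\Gamma$ of universally quantified clauses (disjunctions of inequalities $s\le s'$ or $s<s'$ between terms in the parameters of $S$ and $\Phi$) such that: 1. whenever $\Gamma$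 holds in an interpretation $\mathcal A$ of the parameters over the real numbers, $\Phi$ is an invariant of $S$ w.r.t. $\mathcal A$; 2. $\Gamma$ is the weakest such constraint: whenever $\mathcal A$ satisfies the convexity conditions of $S$ and $\Phi$ is an invariant of $S$ w.r.t. $\mathcal A$, then $\Gamma$ holds in $\mathcal A$. -/

import Mathlib

open FirstOrder

set_option synthInstance.maxSize 1000

/-! ### Parameters, terms, interpretations -/

/-- A finite set of parameters `P_c ∪ P_f`: parametric constants `0, …, numConst - 1` and parametric
functions `0, …, numFun - 1` with their arities. -/
structure ParamSig where
  numConst : ℕ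
  numFun : ℕ
  arity : Fin numFun → ℕ

/-- Function symbols: the arithmetical signature of the real numbers (with a numeral for each
rational number), extended by the parameters. -/
inductive ParamFunc (σ : ParamSig) : ℕ → Type
  | num (q : ℚ) : ParamFunc σ 0
  | add : ParamFunc σ 2
  | mul : ParamFunc σ 2
  | neg : ParamFunc σ 1
  | const (i : Fin σ.numConst) : ParamFunc σ 0
  | fn (j : Fin σ.numFun) : ParamFunc σ (σ.arity j)

/-- The functional language used to write terms in the parameters. (The predicates `≤`, `<` of the
ordered field are provided by `Literal` and `Cmp` below.) -/
abbrev paramLang (σ : ParamSig) : Language := ⟨ParamFunc σ, fun _ => Empty⟩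

/-- An interpretation of the parameters over the real numbers. -/
structure Interp (σ : ParamSig) where
  const : Fin σ.numConst → ℝ
  fn : (j : Fin σ.numFun) → (Fin (σ.arity j) → ℝ) → ℝ

/-- The value of a function symbol; arithmetical symbols have their standard meaning. -/
def Interp.funVal {σ : ParamSig} (A : Interp σ) : {k : ℕ} → ParamFunc σ k → (Fin k → ℝ) → ℝ
  | _, .num q, _ => (q : ℝ)
  | _, .add, v => v 0 + v 1
  | _, .mul, v => v 0 * v 1
  | _, .neg, v => - v 0
  | _, .const i, _ => A.const i
  | _, .fn j, v => A.fn j v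

/-- The first-order structure on `ℝ` given by an interpretation of the parameters. -/
abbrev Interp.toStructure {σ : ParamSig} (A : Interp σ) : (paramLang σ).Structure ℝ where
  funMap := A.funVal
  RelMap := fun r => r.elim

/-- The value of a term with variables in `α` under a valuation `v` of the variables. -/
noncomputable def Interp.val {σ : ParamSig} (A : Interp σ) {α : Type} (v : α → ℝ)
    (s : (paramLang σ).Term α) : ℝ :=
  letI := A.toStructure
  s.realize v

/-- Closed terms, e.g. numerical constants and parametric constants. -/
abbrev Coef (σ : ParamSig) : Type := (paramLang σ).Term Empty

/-- Terms with (at most) one free variable, which stands for time: constants, parametric constants,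
parametric functions applied to the time, and terms built from these. -/
abbrev TimeTerm (σ : ParamSig) : Type := (paramLang σ).Term Unit

noncomputable def Interp.coef {σ : ParamSig} (A : Interp σ) (c : Coef σ) : ℝ :=
  A.val (fun e => e.elim) c

noncomputable def Interp.atTime {σ : ParamSig} (A : Interp σ) (b : TimeTerm σ) (t : ℝ) : ℝ :=
  A.val (fun _ => t) b

/-! ### Universally quantified constraints on the parameters -/

/-- A literal `lhs ≤ rhs` or (if `strict`) `lhs < rhs`, between terms in the parameters. -/
structure Literal (σ : ParamSig) where
  lhs : (paramLang σ).Term ℕ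
  strict : Bool
  rhs : (paramLang σ).Term ℕ

def Literal.Holds {σ : ParamSig} (A : Interp σ) (v : ℕ → ℝ) (l : Literal σ) : Prop :=
  if l.strict then A.val v l.lhs < A.val v l.rhs else A.val v l.lhs ≤ A.val v l.rhs

/-- A clause is a finite disjunction of literals. -/
abbrev Clause (σ : ParamSig) : Type := List (Literal σ)

/-- A finite set of clauses, i.e. the conjunction of its clauses, all variables being implicitly
universally quantified. -/
abbrev ClauseSet (σ : ParamSig) : Type := List (Clause σ)

/-- The universal closure of a set of clauses is true in the interpretation `A`. -/
def ClauseSet.Holds {σ : ParamSig} (A : Interp σ) (Γ : ClauseSet σ) : Prop :=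
  ∀ v : ℕ → ℝ, ∀ C ∈ Γ, ∃ l ∈ C, l.Holds A v

/-! ### Hybrid automata and inductive invariants -/

/-- A hybrid automaton with `n` real-valued variables, `m` control modes and `k` control switches.
All predicates may depend on the time (their first real argument). `timeAfter e t` is the time
at which the automaton is in the target mode after the instantaneous switch `e` at time `t`. -/
structure HybridAutomaton (n m k : ℕ) where
  flow : Fin m → ℝ → (Fin n → ℝ) → (Fin n → ℝ) → Prop
  inv : Fin m → ℝ → (Fin n → ℝ) → Prop
  initial : Fin m → ℝ → (Fin n → ℝ) → Prop
  source : Fin k → Fin m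
  target : Fin k → Fin m
  guard : Fin k → ℝ → (Fin n → ℝ) → Prop
  jump : Fin k → ℝ → (Fin n → ℝ) → (Fin n → ℝ) → Prop
  timeAfter : Fin k → ℝ → ℝ

namespace HybridAutomaton

variable {n m k : ℕ}

/-- `x` is a flow of mode `q` during the time interval `[t₀, t₁]`: it evolves continuously, all its
states are admissible, and it is differentiable with a derivative that obeys the flow condition. -/
def IsFlow (H : HybridAutomaton n m k) (q : Fin m) (t₀ t₁ : ℝ) (x : ℝ → Fin n → ℝ) : Prop :=
  ContinuousOn x (Set.Icc t₀ t₁) ∧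
  (∀ t ∈ Set.Icc t₀ t₁, H.inv q t (x t)) ∧
  ∀ t ∈ Set.Ioo t₀ t₁, ∃ v : Fin n → ℝ, HasDerivAt x v t ∧ H.flow q t (x t) v

/-- `(t, a) ↦ (timeAfter e t, a')` is a jump along the switch `e` between admissible states. -/
def IsJump (H : HybridAutomaton n m k) (e : Fin k) (t : ℝ) (a a' : Fin n → ℝ) : Prop :=
  H.inv (H.source e) t a ∧ H.guard e t a ∧ H.jump e t a a' ∧
    H.inv (H.target e) (H.timeAfter e t) a'

/-- `Φ` is an (inductive) invariant: it is true in all initial states and it is preserved under all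
flows and all jumps. Time is non-negative. -/
def IsInvariant (H : HybridAutomaton n m k) (Φ : ℝ → (Fin n → ℝ) → Prop) : Prop :=
  (∀ q t a, 0 ≤ t → H.initial q t a → Φ t a) ∧
  (∀ q t₀ t₁ x, 0 ≤ t₀ → t₀ ≤ t₁ → H.IsFlow q t₀ t₁ x → Φ t₀ (x t₀) → Φ t₁ (x t₁)) ∧
  (∀ e t a a', 0 ≤ t → H.IsJump e t a a' → Φ t a → Φ (H.timeAfter e t) a')

end HybridAutomaton

/-! ### Parametric linear hybrid automata -/

inductive Cmp
  | le | lt | ge | gt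

def Cmp.Holds : Cmp → ℝ → ℝ → Prop
  | le, a, b => a ≤ b
  | lt, a, b => a < b
  | ge, a, b => a ≥ b
  | gt, a, b => a > b

/-- A closed interval `[lo, hi]` of times; a missing endpoint stands for `-∞`, resp. `+∞`. -/
structure TimeInterval (σ : ParamSig) where
  lo : Option (Coef σ)
  hi : Option (Coef σ)

def TimeInterval.toSet {σ : ParamSig} (A : Interp σ) (I : TimeInterval σ) : Set ℝ :=
  {t | (∀ c ∈ I.lo, A.coef c ≤ t) ∧ (∀ c ∈ I.hi, t ≤ A.coef c)}

/-- The constraint `∑ i, a i * x i ⋈ bound(t)` for times `t` in an interval. -/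
structure StateIneq (σ : ParamSig) (n : ℕ) where
  coeff : Fin n → Coef σ
  rel : Cmp
  bound : TimeTerm σ
  interval : TimeInterval σ

def StateIneq.Holds {σ : ParamSig} {n : ℕ} (A : Interp σ) (c : StateIneq σ n) (t : ℝ)
    (x : Fin n → ℝ) : Prop :=
  t ∈ c.interval.toSet A → c.rel.Holds (∑ i, A.coef (c.coeff i) * x i) (A.atTime c.bound t)

/-- Upper bounds are concave and lower bounds are convex functions of the time, on the interval
of the constraint. -/
def StateIneq.BoundShape {σ : ParamSig} {n : ℕ} (A : Interp σ) (c : StateIneq σ n) : Prop :=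
  match c.rel with
  | .le | .lt => ConcaveOn ℝ (c.interval.toSet A) (A.atTime c.bound)
  | .ge | .gt => ConvexOn ℝ (c.interval.toSet A) (A.atTime c.bound)

/-- The non-strict constraint `∑ i, b i * ẋ i ≤ bound` for times in an interval. -/
structure FlowIneq (σ : ParamSig) (n : ℕ) where
  coeff : Fin n → Coef σ
  bound : Coef σ
  interval : TimeInterval σ

def FlowIneq.Holds {σ : ParamSig} {n : ℕ} (A : Interp σ) (c : FlowIneq σ n) (t : ℝ)
    (v : Fin n → ℝ) : Prop :=
  t ∈ c.interval.toSet A → ∑ i, A.coef (c.coeff i) * v i ≤ A.coef c.bound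

/-- The constraint `∑ i, (b i * x i + c i * x' i) ⋈ bound(t)` for times `t` in an interval. -/
structure JumpIneq (σ : ParamSig) (n : ℕ) where
  coeff : Fin n → Coef σ
  coeff' : Fin n → Coef σ
  rel : Cmp
  bound : TimeTerm σ
  interval : TimeInterval σ

def JumpIneq.Holds {σ : ParamSig} {n : ℕ} (A : Interp σ) (c : JumpIneq σ n) (t : ℝ)
    (x x' : Fin n → ℝ) : Prop :=
  t ∈ c.interval.toSet A →
    c.rel.Holds (∑ i, (A.coef (c.coeff i) * x i + A.coef (c.coeff' i) * x' i))
      (A.atTime c.bound t)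

/-- Convex linear predicates over the variables, possibly with parameters: finite conjunctions. -/
abbrev ConvexPred (σ : ParamSig) (n : ℕ) : Type := List (StateIneq σ n)

def ConvexPred.Holds {σ : ParamSig} {n : ℕ} (A : Interp σ) (P : ConvexPred σ n) (t : ℝ)
    (x : Fin n → ℝ) : Prop :=
  ∀ c ∈ P, StateIneq.Holds A c t x

structure PMode (σ : ParamSig) (n : ℕ) where
  flow : List (FlowIneq σ n)
  inv : ConvexPred σ n
  initial : ConvexPred σ n

/-- A control switch. If `restart` is set, time is counted from `0` again after the switch,
otherwise it continues. -/
structure PSwitch (σ : ParamSig) (n m : ℕ) where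
  source : Fin m
  target : Fin m
  guard : ConvexPred σ n
  jump : List (JumpIneq σ n)
  restart : Bool

/-- A parametric linear hybrid automaton with parameters `σ` and `n` variables. -/
structure PLHA (σ : ParamSig) (n : ℕ) where
  numModes : ℕ
  mode : Fin numModes → PMode σ n
  switches : List (PSwitch σ n numModes)

namespace PLHA

variable {σ : ParamSig} {n : ℕ}

/-- The hybrid automaton which an interpretation of the parameters makes of a PLHA. -/
def interpret (S : PLHA σ n) (A : Interp σ) :
    HybridAutomaton n S.numModes S.switches.length where
  flow q t _ v := ∀ c ∈ (S.mode q).flow, FlowIneq.Holds A c t v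
  inv q := ConvexPred.Holds A (S.mode q).inv
  initial q := ConvexPred.Holds A (S.mode q).initial
  source e := (S.switches.get e).source
  target e := (S.switches.get e).target
  guard e := ConvexPred.Holds A (S.switches.get e).guard
  jump e t x x' := ∀ c ∈ (S.switches.get e).jump, JumpIneq.Holds A c t x x'
  timeAfter e t := if (S.switches.get e).restart then 0 else t

/-- The interpretation satisfies the convexity conditions for the lower bounds and the concavity
conditions for the upper bounds in the mode invariants, initial conditions and guards. -/
def BoundShape (S : PLHA σ n) (A : Interp σ) : Prop :=
  (∀ q, (∀ c ∈ (S.mode q).inv, StateIneq.BoundShape A c) ∧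
    (∀ c ∈ (S.mode q).initial, StateIneq.BoundShape A c)) ∧
  (∀ e ∈ S.switches, ∀ c ∈ e.guard, StateIneq.BoundShape A c)

end PLHA

/-! ### Codes: the syntax as input and output of algorithms

Terms are written in Polish notation, as lists of tokens; everything else is coded structurally by
tuples and lists. -/

abbrev Token : Type := ℕ × ℤ × ℕ

def ParamFunc.token {σ : ParamSig} : {k : ℕ} → ParamFunc σ k → Token
  | _, .num q => (0, q.num, q.den)
  | _, .add => (1, 0, 0)
  | _, .mul => (2, 0, 0)
  | _, .neg => (3, 0, 0)
  | _, .const i => (4, (i : ℕ), 0)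
  | _, .fn j => (5, (j : ℕ), σ.arity j)

/-- The code of a term whose variables are numbered by `idx`. -/
def termCode {σ : ParamSig} {α : Type} (idx : α → ℕ) (s : (paramLang σ).Term α) : List Token :=
  s.listEncode.map (Sum.elim (fun a => (6, (idx a : ℤ), 0)) (fun f => ParamFunc.token f.2))

def Coef.code {σ : ParamSig} (c : Coef σ) : List Token := termCode (fun e => e.elim) c

def TimeTerm.code {σ : ParamSig} (b : TimeTerm σ) : List Token := termCode (fun _ => 0) b

abbrev LiteralCode : Type := List Token × Bool × List Token

def Literal.code {σ : ParamSig} (l : Literal σ) : LiteralCode :=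
  (termCode id l.lhs, l.strict, termCode id l.rhs)

def ClauseSet.code {σ : ParamSig} (Γ : ClauseSet σ) : List (List LiteralCode) :=
  Γ.map (fun C => C.map Literal.code)

def Cmp.code : Cmp → ℕ
  | le => 0
  | lt => 1
  | ge => 2
  | gt => 3

abbrev TimeIntervalCode : Type := Option (List Token) × Option (List Token)

def TimeInterval.code {σ : ParamSig} (I : TimeInterval σ) : TimeIntervalCode :=
  (I.lo.map Coef.code, I.hi.map Coef.code)

def coeffCode {σ : ParamSig} {n : ℕ} (a : Fin n → Coef σ) : List (List Token) :=
  List.ofFn (fun i => Coef.code (a i))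

abbrev StateIneqCode : Type := List (List Token) × ℕ × List Token × TimeIntervalCode

def StateIneq.code {σ : ParamSig} {n : ℕ} (c : StateIneq σ n) : StateIneqCode :=
  (coeffCode c.coeff, c.rel.code, TimeTerm.code c.bound, c.interval.code)

def ConvexPred.code {σ : ParamSig} {n : ℕ} (P : ConvexPred σ n) : List StateIneqCode :=
  P.map StateIneq.code

abbrev FlowIneqCode : Type := List (List Token) × List Token × TimeIntervalCode

def FlowIneq.code {σ : ParamSig} {n : ℕ} (c : FlowIneq σ n) : FlowIneqCode :=
  (coeffCode c.coeff, Coef.code c.bound, c.interval.code)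

abbrev JumpIneqCode : Type :=
  List (List Token) × List (List Token) × ℕ × List Token × TimeIntervalCode

def JumpIneq.code {σ : ParamSig} {n : ℕ} (c : JumpIneq σ n) : JumpIneqCode :=
  (coeffCode c.coeff, coeffCode c.coeff', c.rel.code, TimeTerm.code c.bound, c.interval.code)

abbrev PModeCode : Type := List FlowIneqCode × List StateIneqCode × List StateIneqCode

def PMode.code {σ : ParamSig} {n : ℕ} (M : PMode σ n) : PModeCode :=
  (M.flow.map FlowIneq.code, ConvexPred.code M.inv, ConvexPred.code M.initial)

abbrev PSwitchCode : Type := ℕ × ℕ × List StateIneqCode × List JumpIneqCode × Bool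

def PSwitch.code {σ : ParamSig} {n m : ℕ} (e : PSwitch σ n m) : PSwitchCode :=
  (e.source, e.target, ConvexPred.code e.guard, e.jump.map JumpIneq.code, e.restart)

abbrev ParamSigCode : Type := ℕ × List ℕ

def ParamSig.code (σ : ParamSig) : ParamSigCode := (σ.numConst, List.ofFn σ.arity)

abbrev PLHACode : Type := ParamSigCode × ℕ × List PModeCode × List PSwitchCode

def PLHA.code {σ : ParamSig} {n : ℕ} (S : PLHA σ n) : PLHACode :=
  (σ.code, n, List.ofFn (fun q => (S.mode q).code), S.switches.map PSwitch.code)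

/-! ### Terms -/

namespace ParamTerm

variable {σ : ParamSig} {α : Type}

/-! Preservation by initial states and by jumps is already a universal statement about one time and
one or two states. Only flows quantify over functions, and they are eliminated by keeping just their
endpoints. Call the endpoints of the time intervals of the flow and mode invariant constraints
breakpoints. Between two times with no breakpoint strictly in between, a constraint is either in
force throughout or nowhere in the interior. On such a period the mean value theorem shows that a
flow satisfies the flow condition averaged over the period (`sum_mul_sub_le_of_hasDerivAt`).
Conversely, if two states satisfy the averaged condition and the mode invariant, uniform motion
along the segment between them is a flow: its velocity is the average velocity, and concave upper
and convex lower bounds that hold at both ends hold in between (`PLHA.isFlow_segment`). A longer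
flow is cut at the breakpoints, and the property is carried from piece to piece
(`preserved_of_forall_breakpoints`).

What remains are implications between conjunctions of clauses, with variables for times and
coordinates. Negated inequalities are inequalities, so distributing turns each implication into
finitely many clauses (`forall_mem_implicationClauses`). Parametric functions stay in place as
terms.

For computability the construction is repeated on token lists. Coding commutes with every operation
involved (`PLHA.code_invariantClauses`), and the operations on codes are primitive recursive
(`PLHACode.primrec_invariantClauses`). -/

def num (q : ℚ) : (paramLang σ).Term α :=
  Language.Term.func (L := paramLang σ) (ParamFunc.num q) ![]

def add (s t : (paramLang σ).Term α) : (paramLang σ).Term α :=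
  Language.Term.func (L := paramLang σ) ParamFunc.add ![s, t]

def mul (s t : (paramLang σ).Term α) : (paramLang σ).Term α :=
  Language.Term.func (L := paramLang σ) ParamFunc.mul ![s, t]

def neg (s : (paramLang σ).Term α) : (paramLang σ).Term α :=
  Language.Term.func (L := paramLang σ) ParamFunc.neg ![s]

/-- A closed term as a term with variables. -/
def ofCoef (c : Coef σ) : (paramLang σ).Term ℕ :=
  Language.Term.relabel (fun e => e.elim) c

/-- Substitution of a term for the time. -/
def atTime (τ : (paramLang σ).Term ℕ) (b : TimeTerm σ) : (paramLang σ).Term ℕ :=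
  Language.Term.subst b (fun _ => τ)

/-- The linear form `∑ i, a i * y i`, where `y i` is the variable with number `2 * i + k`. -/
def lin {n : ℕ} (a : Fin n → Coef σ) (k : ℕ) : (paramLang σ).Term ℕ :=
  ((List.finRange n).map fun i => mul (ofCoef (a i)) (.var (2 * (i : ℕ) + k))).foldr add (num 0)

section Val

variable (A : Interp σ) (v : α → ℝ) (w : ℕ → ℝ)

@[simp] theorem val_var (a : α) : A.val v (.var a) = v a := rfl

@[simp] theorem val_num (q : ℚ) : A.val v (num q) = q := rfl

@[simp] theorem val_add (s t : (paramLang σ).Term α) :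
    A.val v (add s t) = A.val v s + A.val v t := rfl

@[simp] theorem val_mul (s t : (paramLang σ).Term α) :
    A.val v (mul s t) = A.val v s * A.val v t := rfl

@[simp] theorem val_neg (s : (paramLang σ).Term α) : A.val v (neg s) = - A.val v s := rfl

@[simp] theorem val_ofCoef (c : Coef σ) : A.val w (ofCoef c) = A.coef c := by
  let := A.toStructure
  have h : w ∘ (fun e : Empty => e.elim) = fun e : Empty => e.elim := by
    funext e; exact e.elim
  simp only [Interp.coef, Interp.val, ofCoef, Language.Term.realize_relabel, h]

@[simp] theorem val_atTime (τ : (paramLang σ).Term ℕ) (b : TimeTerm σ) :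
    A.val w (atTime τ b) = A.atTime b (A.val w τ) := by
  let := A.toStructure
  simp only [Interp.atTime, Interp.val, atTime, Language.Term.realize_subst]

@[simp] theorem val_lin {n : ℕ} (a : Fin n → Coef σ) (k : ℕ) :
    A.val w (lin a k) = ∑ i, A.coef (a i) * w (2 * (i : ℕ) + k) := by
  have h : ∀ l : List (Fin n), A.val w
      ((l.map fun i => mul (ofCoef (a i)) (.var (2 * (i : ℕ) + k))).foldr add (num 0)) =
      (l.map fun i => A.coef (a i) * w (2 * (i : ℕ) + k)).sum := by
    intro l
    induction l with
    | nil => simp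
    | cons i l ih => simp [ih]
  rw [lin, h, ← List.ofFn_eq_map, List.sum_ofFn]

end Val

end ParamTerm

/-! ### Literals, clauses and implications between sets of clauses -/

section Implications

variable {α β : Type}

/-- The clauses stating that all clauses of `P` together imply all clauses of `Q`, where `neg`
negates a literal. -/
def implicationClauses (neg : α → α) (P Q : List (List α)) : List (List α) :=
  P.sections.flatMap fun s => Q.map fun C => s.map neg ++ C

theorem List.sections_map (f : α → β) (P : List (List α)) :
    (P.map (List.map f)).sections = P.sections.map (List.map f) := by
  induction P with
  | nil => rfl
  | cons C P ih =>
    simp [List.sections, ih, List.flatMap_map, List.map_flatMap, Function.comp_def]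

/-- Naturality in the type of literals. It is applied with the coding of literals as `f`, so that
one construction serves both syntax and codes. -/
theorem implicationClauses_map {neg : α → α} {neg' : β → β} {f : α → β}
    (h : ∀ a, f (neg a) = neg' (f a)) (P Q : List (List α)) :
    (implicationClauses neg P Q).map (List.map f) =
      implicationClauses neg' (P.map (List.map f)) (Q.map (List.map f)) := by
  simp [implicationClauses, List.sections_map, List.flatMap_map, List.map_flatMap,
    Function.comp_def, h]

/-- A section chooses one element from each list. If every list has an element with `p`, choosing
these gives a section without a failing element; a list that has none puts a failing element into
every section. -/
theorem forall_mem_sections {p : α → Prop} (P : List (List α)) :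
    (∀ s ∈ P.sections, ∃ a ∈ s, ¬ p a) ↔ ¬ ∀ C ∈ P, ∃ a ∈ C, p a := by
  induction P with
  | nil => simp
  | cons C P ih =>
    simp only [List.sections, List.mem_flatMap, List.mem_map, forall_exists_index, and_imp,
      List.forall_mem_cons, not_and_or, ← ih]
    constructor
    · intro h
      by_contra! hc
      obtain ⟨⟨a, ha, hpa⟩, s, hs, hps⟩ := hc
      obtain ⟨b, hb, hpb⟩ := h _ s hs a ha rfl
      rcases List.mem_cons.1 hb with rfl | hb
      · exact hpb hpa
      · exact hpb (hps b hb)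
    · rintro h _ s hs a ha rfl
      rcases h with h | h
      · exact ⟨a, List.mem_cons_self, fun hp => h ⟨a, ha, hp⟩⟩
      · obtain ⟨b, hb, hpb⟩ := h s hs
        exact ⟨b, List.mem_cons_of_mem _ hb, hpb⟩

/-- The implication is read as "not `P`, or `Q`". The first alternative says that each section of
`P` has a failing element, and distributing the disjunction over sections and clauses of `Q` gives
the list. -/
theorem forall_mem_implicationClauses {neg : α → α} {p : α → Prop}
    (hneg : ∀ a, p (neg a) ↔ ¬ p a) (P Q : List (List α)) :
    (∀ C ∈ implicationClauses neg P Q, ∃ a ∈ C, p a) ↔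
      ((∀ C ∈ P, ∃ a ∈ C, p a) → ∀ C ∈ Q, ∃ a ∈ C, p a) := by
  have key : ∀ s C : List α, (∃ a ∈ s.map neg ++ C, p a) ↔ (∃ a ∈ s, ¬ p a) ∨ ∃ a ∈ C, p a := by
    simp [or_and_right, exists_or, hneg]
  rw [imp_iff_not_or, ← forall_mem_sections]
  simp only [implicationClauses, List.mem_flatMap, List.mem_map, forall_exists_index, and_imp]
  constructor
  · intro h
    by_contra! hc
    obtain ⟨⟨s, hs, hps⟩, C, hC, hpC⟩ := hc
    rcases (key s C).1 (h _ s hs C hC rfl) with ⟨a, ha, hpa⟩ | ⟨a, ha, hpa⟩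
    · exact hpa (hps a ha)
    · exact hpC a ha hpa
  · rintro h _ s hs C hC rfl
    exact (key s C).2 (h.imp (fun h => h s hs) (fun h => h C hC))

end Implications

namespace Literal

variable {σ : ParamSig} {A : Interp σ} {v : ℕ → ℝ}

def le (s t : (paramLang σ).Term ℕ) : Literal σ := ⟨s, false, t⟩

def lt (s t : (paramLang σ).Term ℕ) : Literal σ := ⟨s, true, t⟩

def neg (l : Literal σ) : Literal σ := ⟨l.rhs, !l.strict, l.lhs⟩

def ofCmp (r : Cmp) (s t : (paramLang σ).Term ℕ) : Literal σ :=
  match r with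
  | .le => le s t
  | .lt => lt s t
  | .ge => le t s
  | .gt => lt t s

@[simp] theorem holds_le (s t : (paramLang σ).Term ℕ) :
    (le s t).Holds A v ↔ A.val v s ≤ A.val v t := by simp [Holds, le]

@[simp] theorem holds_lt (s t : (paramLang σ).Term ℕ) :
    (lt s t).Holds A v ↔ A.val v s < A.val v t := by simp [Holds, lt]

/-- By totality of the order, swapping the sides and toggling strictness negates an inequality; no
negated literals are needed. -/
theorem holds_neg (l : Literal σ) : l.neg.Holds A v ↔ ¬ l.Holds A v := by
  rcases l with ⟨s, _ | _, t⟩ <;> simp [Holds, neg]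

@[simp] theorem holds_ofCmp (r : Cmp) (s t : (paramLang σ).Term ℕ) :
    (ofCmp r s t).Holds A v ↔ r.Holds (A.val v s) (A.val v t) := by
  cases r <;> simp [ofCmp, Cmp.Holds]

end Literal

def Clause.Holds {σ : ParamSig} (A : Interp σ) (v : ℕ → ℝ) (C : Clause σ) : Prop :=
  ∃ l ∈ C, l.Holds A v

def ClauseSet.HoldsAt {σ : ParamSig} (A : Interp σ) (v : ℕ → ℝ) (Γ : ClauseSet σ) : Prop :=
  ∀ C ∈ Γ, Clause.Holds A v C

def ClauseSet.implies {σ : ParamSig} (P Q : ClauseSet σ) : ClauseSet σ :=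
  implicationClauses Literal.neg P Q

section Holds

variable {σ : ParamSig} {n : ℕ} {A : Interp σ} {v : ℕ → ℝ}

@[simp] theorem Clause.holds_nil : ¬ Clause.Holds A v [] := by simp [Clause.Holds]

@[simp] theorem Clause.holds_cons (l : Literal σ) (C : Clause σ) :
    Clause.Holds A v (l :: C) ↔ l.Holds A v ∨ Clause.Holds A v C := by simp [Clause.Holds]

@[simp] theorem Clause.holds_append (C D : Clause σ) :
    Clause.Holds A v (C ++ D) ↔ Clause.Holds A v C ∨ Clause.Holds A v D := by
  simp [Clause.Holds, or_and_right, exists_or]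

@[simp] theorem ClauseSet.holdsAt_cons (C : Clause σ) (Γ : ClauseSet σ) :
    ClauseSet.HoldsAt A v (C :: Γ) ↔ Clause.Holds A v C ∧ ClauseSet.HoldsAt A v Γ := by
  simp [ClauseSet.HoldsAt]

@[simp] theorem ClauseSet.holdsAt_append (Γ Δ : ClauseSet σ) :
    ClauseSet.HoldsAt A v (Γ ++ Δ) ↔ ClauseSet.HoldsAt A v Γ ∧ ClauseSet.HoldsAt A v Δ := by
  simp [ClauseSet.HoldsAt, or_imp, forall_and]

theorem ClauseSet.holdsAt_map {β : Type} (f : β → Clause σ) (l : List β) :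
    ClauseSet.HoldsAt A v (l.map f) ↔ ∀ b ∈ l, Clause.Holds A v (f b) := by
  simp [ClauseSet.HoldsAt]

theorem ClauseSet.holdsAt_flatMap {β : Type} (f : β → ClauseSet σ) (l : List β) :
    ClauseSet.HoldsAt A v (l.flatMap f) ↔ ∀ b ∈ l, ClauseSet.HoldsAt A v (f b) := by
  simp only [ClauseSet.HoldsAt, List.mem_flatMap]
  grind

@[simp] theorem ClauseSet.holdsAt_implies (P Q : ClauseSet σ) :
    ClauseSet.HoldsAt A v (ClauseSet.implies P Q) ↔
      (ClauseSet.HoldsAt A v P → ClauseSet.HoldsAt A v Q) :=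
  forall_mem_implicationClauses (p := Literal.Holds A v) Literal.holds_neg P Q

theorem ClauseSet.holds_iff {Γ : ClauseSet σ} :
    ClauseSet.Holds A Γ ↔ ∀ v, ClauseSet.HoldsAt A v Γ := Iff.rfl

end Holds

/-! ### The constraints of an automaton as clauses

The variables `0` and `1` stand for the times before and after a flow, the variables `2 * i + 2` and
`2 * i + 3` for the values of `x i` before and after a flow or a jump. -/

section Clauses

open ParamTerm

variable {σ : ParamSig} {n : ℕ}

/-- The clause stating that the interval `[τ₀, τ₁]` is not contained in `I`. -/
def TimeInterval.outsideClause (I : TimeInterval σ) (τ₀ τ₁ : (paramLang σ).Term ℕ) : Clause σ :=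
  I.lo.toList.map (fun c => Literal.lt τ₀ (ofCoef c)) ++
    I.hi.toList.map (fun c => Literal.lt (ofCoef c) τ₁)

/-- The clauses stating that no endpoint of `I` lies strictly between the times `0` and `1`. -/
def TimeInterval.breakClauses (I : TimeInterval σ) : ClauseSet σ :=
  (I.lo.toList ++ I.hi.toList).map fun c =>
    [Literal.le (ofCoef c) (.var 0), Literal.le (.var 1) (ofCoef c)]

/-- With both times equal to `τ`, the outside clause says that `τ` is not in the interval, so the
disjunction is the relativized constraint. The values `k = 2` and `k = 3` select the state before
and after. -/
def StateIneq.clause (τ : (paramLang σ).Term ℕ) (k : ℕ) (c : StateIneq σ n) : Clause σ :=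
  c.interval.outsideClause τ τ ++ [Literal.ofCmp c.rel (lin c.coeff k) (atTime τ c.bound)]

/-- The flow condition averaged over the time interval of a flow. -/
def FlowIneq.clause (c : FlowIneq σ n) : Clause σ :=
  c.interval.outsideClause (.var 0) (.var 1) ++
    [Literal.le (lin c.coeff 3)
      (add (lin c.coeff 2) (mul (ofCoef c.bound) (add (.var 1) (neg (.var 0)))))]

def JumpIneq.clause (c : JumpIneq σ n) : Clause σ :=
  c.interval.outsideClause (.var 0) (.var 0) ++
    [Literal.ofCmp c.rel (add (lin c.coeff 2) (lin c.coeff' 3)) (atTime (.var 0) c.bound)]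

def ConvexPred.clauses (τ : (paramLang σ).Term ℕ) (k : ℕ) (P : ConvexPred σ n) : ClauseSet σ :=
  P.map (StateIneq.clause τ k)

/-- The assumption that a time is non-negative. -/
def nonnegClause : Clause σ := [Literal.le (num 0) (.var 0)]

def PMode.initialClauses (M : PMode σ n) (Φ : ConvexPred σ n) : ClauseSet σ :=
  ClauseSet.implies (nonnegClause :: ConvexPred.clauses (.var 0) 2 M.initial)
    (ConvexPred.clauses (.var 0) 2 Φ)

def PMode.breakClauses (M : PMode σ n) : ClauseSet σ :=
  M.flow.flatMap (fun c => c.interval.breakClauses) ++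
    M.inv.flatMap (fun c => c.interval.breakClauses)

/-- The times may be taken distinct, since a flow of zero duration preserves everything. The break
clauses confine the condition to periods without breakpoints in the interior. -/
def PMode.flowClauses (M : PMode σ n) (Φ : ConvexPred σ n) : ClauseSet σ :=
  ClauseSet.implies
    (nonnegClause :: [Literal.lt (.var 0) (.var 1)] ::
      (M.breakClauses ++ (M.flow.map FlowIneq.clause ++
        (ConvexPred.clauses (.var 0) 2 M.inv ++ (ConvexPred.clauses (.var 1) 3 M.inv ++
          ConvexPred.clauses (.var 0) 2 Φ)))))
    (ConvexPred.clauses (.var 1) 3 Φ)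

def PSwitch.timeAfter {m : ℕ} (e : PSwitch σ n m) : (paramLang σ).Term ℕ :=
  if e.restart then num 0 else .var 0

def PSwitch.clauses {m : ℕ} (mode : Fin m → PMode σ n) (e : PSwitch σ n m)
    (Φ : ConvexPred σ n) : ClauseSet σ :=
  ClauseSet.implies
    (nonnegClause :: (ConvexPred.clauses (.var 0) 2 (mode e.source).inv ++
      (ConvexPred.clauses (.var 0) 2 e.guard ++ (e.jump.map JumpIneq.clause ++
        (ConvexPred.clauses e.timeAfter 3 (mode e.target).inv ++
          ConvexPred.clauses (.var 0) 2 Φ)))))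
    (ConvexPred.clauses e.timeAfter 3 Φ)

/-- The weakest constraints on the parameters under which `Φ` is an invariant of `S`. -/
def PLHA.invariantClauses (S : PLHA σ n) (Φ : ConvexPred σ n) : ClauseSet σ :=
  (List.ofFn S.mode).flatMap (fun M => M.initialClauses Φ ++ M.flowClauses Φ) ++
    S.switches.flatMap (fun e => e.clauses S.mode Φ)

/-! ### Semantics of the clauses -/

variable {A : Interp σ} {v : ℕ → ℝ}

/-- A nonempty closed interval lies in `I` exactly when its left end respects the lower bound and
its right end the upper bound. The order of the times is needed for nonemptiness. -/
theorem TimeInterval.holds_outsideClause (I : TimeInterval σ) (τ₀ τ₁ : (paramLang σ).Term ℕ)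
    (h : A.val v τ₀ ≤ A.val v τ₁) :
    Clause.Holds A v (I.outsideClause τ₀ τ₁) ↔
      ¬ Set.Icc (A.val v τ₀) (A.val v τ₁) ⊆ I.toSet A := by
  have key : Set.Icc (A.val v τ₀) (A.val v τ₁) ⊆ I.toSet A ↔
      (∀ c ∈ I.lo, A.coef c ≤ A.val v τ₀) ∧ (∀ c ∈ I.hi, A.val v τ₁ ≤ A.coef c) :=
    ⟨fun hs => ⟨(hs ⟨le_rfl, h⟩).1, (hs ⟨h, le_rfl⟩).2⟩,
      fun hs t ht => ⟨fun c hc => (hs.1 c hc).trans ht.1, fun c hc => ht.2.trans (hs.2 c hc)⟩⟩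
  rw [key]
  rcases I with ⟨_ | a, _ | b⟩ <;> simp [outsideClause, imp_iff_not_or]

theorem TimeInterval.holdsAt_breakClauses (I : TimeInterval σ) :
    ClauseSet.HoldsAt A v I.breakClauses ↔
      ∀ c ∈ I.lo.toList ++ I.hi.toList, A.coef c ∉ Set.Ioo (v 0) (v 1) := by
  rw [breakClauses, ClauseSet.holdsAt_map]
  simp [imp_iff_not_or]

theorem StateIneq.holds_clause (τ : (paramLang σ).Term ℕ) (k : ℕ) (c : StateIneq σ n) :
    Clause.Holds A v (c.clause τ k) ↔ c.Holds A (A.val v τ) (fun i => v (2 * (i : ℕ) + k)) := by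
  simp [clause, StateIneq.Holds, TimeInterval.holds_outsideClause, imp_iff_not_or]

theorem JumpIneq.holds_clause (c : JumpIneq σ n) :
    Clause.Holds A v c.clause ↔
      c.Holds A (v 0) (fun i => v (2 * (i : ℕ) + 2)) (fun i => v (2 * (i : ℕ) + 3)) := by
  have h := c.interval.holds_outsideClause (A := A) (v := v) (.var 0) (.var 0) le_rfl
  simp [clause, JumpIneq.Holds, h, imp_iff_not_or, Finset.sum_add_distrib]

/-- The averaged condition is multiplied by the elapsed time because terms have no division. -/
theorem FlowIneq.holds_clause (c : FlowIneq σ n) (h : v 0 ≤ v 1) :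
    Clause.Holds A v c.clause ↔
      (Set.Icc (v 0) (v 1) ⊆ c.interval.toSet A →
        ∑ i, A.coef (c.coeff i) * (v (2 * (i : ℕ) + 3) - v (2 * (i : ℕ) + 2)) ≤
          A.coef c.bound * (v 1 - v 0)) := by
  have h' := c.interval.holds_outsideClause (A := A) (v := v) (.var 0) (.var 1) h
  have hs : ∑ i, A.coef (c.coeff i) * (v (2 * (i : ℕ) + 3) - v (2 * (i : ℕ) + 2)) =
      A.val v (lin c.coeff 3) - A.val v (lin c.coeff 2) := by
    simp [mul_sub, Finset.sum_sub_distrib]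
  rw [hs, sub_le_iff_le_add', imp_iff_not_or]
  simp only [clause, Clause.holds_append, h', Clause.holds_cons, Clause.holds_nil, or_false,
    Literal.holds_le, val_add, val_mul, val_neg, val_ofCoef, val_var, ← sub_eq_add_neg]

theorem ConvexPred.holdsAt_clauses (τ : (paramLang σ).Term ℕ) (k : ℕ) (P : ConvexPred σ n) :
    ClauseSet.HoldsAt A v (P.clauses τ k) ↔
      P.Holds A (A.val v τ) (fun i => v (2 * (i : ℕ) + k)) := by
  simp only [clauses, ClauseSet.holdsAt_map, StateIneq.holds_clause, ConvexPred.Holds]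

theorem holds_nonnegClause : Clause.Holds A v nonnegClause ↔ 0 ≤ v 0 := by simp [nonnegClause]

/-- The endpoints of the time intervals of the constraints on the flows of a mode. -/
def PMode.breakpoints (M : PMode σ n) : List (Coef σ) :=
  M.flow.flatMap (fun c => c.interval.lo.toList ++ c.interval.hi.toList) ++
    M.inv.flatMap (fun c => c.interval.lo.toList ++ c.interval.hi.toList)

theorem PMode.holdsAt_breakClauses (M : PMode σ n) :
    ClauseSet.HoldsAt A v M.breakClauses ↔
      ∀ b ∈ M.breakpoints, A.coef b ∉ Set.Ioo (v 0) (v 1) := by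
  simp only [breakClauses, breakpoints, ClauseSet.holdsAt_append, ClauseSet.holdsAt_flatMap,
    TimeInterval.holdsAt_breakClauses, List.mem_append, List.mem_flatMap]
  grind

/-- A valuation of the variables with given values of times and states. -/
noncomputable def stateValuation (t₀ t₁ : ℝ) (x₀ x₁ : Fin n → ℝ) (j : ℕ) : ℝ :=
  if j = 0 then t₀ else if j = 1 then t₁ else
    -- For `j = 2 * i + 2` and `j = 2 * i + 3` the index `j / 2 - 1` is `i`, and the parity tells
    -- the state before from the state after. The other variables get the irrelevant value 0.
    if h : j / 2 - 1 < n then (if j % 2 = 0 then x₀ ⟨_, h⟩ else x₁ ⟨_, h⟩) else 0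

section Valuation

variable (t₀ t₁ : ℝ) (x₀ x₁ : Fin n → ℝ)

@[simp] theorem stateValuation_zero : stateValuation t₀ t₁ x₀ x₁ 0 = t₀ := rfl

@[simp] theorem stateValuation_one : stateValuation t₀ t₁ x₀ x₁ 1 = t₁ := rfl

@[simp] theorem stateValuation_before (i : Fin n) :
    stateValuation t₀ t₁ x₀ x₁ (2 * (i : ℕ) + 2) = x₀ i := by
  simp [stateValuation]

@[simp] theorem stateValuation_after (i : Fin n) :
    stateValuation t₀ t₁ x₀ x₁ (2 * (i : ℕ) + 3) = x₁ i := by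
  have h : (2 * (i : ℕ) + 3) / 2 - 1 = i := by omega
  have h' : (2 * (i : ℕ) + 3) % 2 = 1 := by omega
  simp only [stateValuation, h, h']
  simp

end Valuation

/-- A universal statement about the times and states is one about all valuations. -/
theorem forall_valuation_iff {p : ℝ → ℝ → (Fin n → ℝ) → (Fin n → ℝ) → Prop} :
    (∀ v : ℕ → ℝ, p (v 0) (v 1) (fun i => v (2 * (i : ℕ) + 2)) (fun i => v (2 * (i : ℕ) + 3))) ↔
      ∀ t₀ t₁ x₀ x₁, p t₀ t₁ x₀ x₁ := by
  refine ⟨fun h t₀ t₁ x₀ x₁ => ?_, fun h v => h _ _ _ _⟩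
  simpa using h (stateValuation t₀ t₁ x₀ x₁)

theorem PMode.holds_initialClauses (M : PMode σ n) (Φ : ConvexPred σ n) :
    ClauseSet.Holds A (M.initialClauses Φ) ↔
      ∀ t a, 0 ≤ t → M.initial.Holds A t a → Φ.Holds A t a := by
  simp only [ClauseSet.holds_iff, initialClauses, ClauseSet.holdsAt_implies,
    ClauseSet.holdsAt_cons, holds_nonnegClause, ConvexPred.holdsAt_clauses, ParamTerm.val_var]
  rw [forall_valuation_iff (p := fun t _ x _ => 0 ≤ t ∧ M.initial.Holds A t x → Φ.Holds A t x)]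
  exact ⟨fun h t x h0 hx => h t 0 x 0 ⟨h0, hx⟩, fun h t _ x _ hx => h t x hx.1 hx.2⟩

/-- `Φ` is preserved under a change of state from `(t₀, x₀)` to `(t₁, x₁)` that obeys the mode
invariant at both ends and the averaged flow condition. -/
def PMode.PreservesStep (A : Interp σ) (M : PMode σ n) (Φ : ConvexPred σ n) (t₀ t₁ : ℝ)
    (x₀ x₁ : Fin n → ℝ) : Prop :=
  (∀ c ∈ M.flow, Set.Icc t₀ t₁ ⊆ c.interval.toSet A →
    ∑ i, A.coef (c.coeff i) * (x₁ i - x₀ i) ≤ A.coef c.bound * (t₁ - t₀)) →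
  M.inv.Holds A t₀ x₀ → M.inv.Holds A t₁ x₁ → Φ.Holds A t₀ x₀ → Φ.Holds A t₁ x₁

theorem PMode.holds_flowClauses (M : PMode σ n) (Φ : ConvexPred σ n) :
    ClauseSet.Holds A (M.flowClauses Φ) ↔
      ∀ t₀ t₁ x₀ x₁, 0 ≤ t₀ → t₀ < t₁ → (∀ b ∈ M.breakpoints, A.coef b ∉ Set.Ioo t₀ t₁) →
        M.PreservesStep A Φ t₀ t₁ x₀ x₁ := by
  rw [← forall_valuation_iff (p := fun t₀ t₁ x₀ x₁ => 0 ≤ t₀ → t₀ < t₁ →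
    (∀ b ∈ M.breakpoints, A.coef b ∉ Set.Ioo t₀ t₁) → M.PreservesStep A Φ t₀ t₁ x₀ x₁),
    ClauseSet.holds_iff]
  refine forall_congr' fun v => ?_
  simp only [flowClauses, ClauseSet.holdsAt_implies, ClauseSet.holdsAt_cons,
    ClauseSet.holdsAt_append, holds_nonnegClause, ConvexPred.holdsAt_clauses, ParamTerm.val_var,
    Clause.holds_cons, Clause.holds_nil, or_false, Literal.holds_lt, PMode.holdsAt_breakClauses,
    ClauseSet.holdsAt_map, and_imp, PreservesStep]
  -- The order of the times has to be in scope, since the meaning of the flow clauses depends on it.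
  refine forall_congr' fun _ => forall_congr' fun h => forall_congr' fun _ => ?_
  simp only [FlowIneq.holds_clause _ h.le]

theorem PSwitch.holds_clauses {m : ℕ} (mode : Fin m → PMode σ n) (e : PSwitch σ n m)
    (Φ : ConvexPred σ n) :
    ClauseSet.Holds A (e.clauses mode Φ) ↔
      ∀ t x x', 0 ≤ t → (mode e.source).inv.Holds A t x → e.guard.Holds A t x →
        (∀ c ∈ e.jump, c.Holds A t x x') →
        (mode e.target).inv.Holds A (if e.restart then 0 else t) x' → Φ.Holds A t x →
        Φ.Holds A (if e.restart then 0 else t) x' := by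
  have hτ : ∀ v : ℕ → ℝ, A.val v e.timeAfter = if e.restart then 0 else v 0 := by
    intro v; unfold timeAfter; split <;> simp
  simp only [ClauseSet.holds_iff, clauses, ClauseSet.holdsAt_implies, ClauseSet.holdsAt_cons,
    ClauseSet.holdsAt_append, holds_nonnegClause, ConvexPred.holdsAt_clauses, ParamTerm.val_var,
    ClauseSet.holdsAt_map, JumpIneq.holds_clause, and_imp, hτ]
  rw [forall_valuation_iff (p := fun t _ x x' =>
    0 ≤ t → (mode e.source).inv.Holds A t x → e.guard.Holds A t x →
        (∀ c ∈ e.jump, c.Holds A t x x') →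
        (mode e.target).inv.Holds A (if e.restart then 0 else t) x' → Φ.Holds A t x →
        Φ.Holds A (if e.restart then 0 else t) x')]
  exact ⟨fun h t x x' => h t 0 x x', fun h t _ x x' => h t x x'⟩

theorem PLHA.holds_invariantClauses (S : PLHA σ n) (Φ : ConvexPred σ n) :
    ClauseSet.Holds A (S.invariantClauses Φ) ↔
      (∀ q, ClauseSet.Holds A ((S.mode q).initialClauses Φ)) ∧
      (∀ q, ClauseSet.Holds A ((S.mode q).flowClauses Φ)) ∧
      ∀ e ∈ S.switches, ClauseSet.Holds A (e.clauses S.mode Φ) := by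
  simp only [ClauseSet.holds_iff, invariantClauses, ClauseSet.holdsAt_append,
    ClauseSet.holdsAt_flatMap, List.forall_mem_ofFn_iff]
  grind

end Clauses

/-! ### The clauses characterize invariants -/

/-- A property which is preserved between times without a breakpoint in between is preserved
between any two times. -/
theorem preserved_of_forall_breakpoints {p : ℝ → Prop} (B : List ℝ) {t₀ t₁ : ℝ} (h : t₀ ≤ t₁)
    (step : ∀ s₀ s₁, t₀ ≤ s₀ → s₀ < s₁ → s₁ ≤ t₁ → (∀ b ∈ B, b ∉ Set.Ioo s₀ s₁) → p s₀ → p s₁) :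
    p t₀ → p t₁ := by
  induction B generalizing t₀ t₁ with
  | nil =>
    rcases h.eq_or_lt with rfl | h
    · exact id
    · exact step t₀ t₁ le_rfl h le_rfl (by simp)
  | cons b B ih =>
    -- An interior `b` splits the interval, and it is interior to no subinterval of either half.
    -- Otherwise `b` is interior to no subinterval at all.
    by_cases hb : b ∈ Set.Ioo t₀ t₁
    · intro h0
      refine ih hb.2.le (fun s₀ s₁ h₀ h₁ h₂ hB => step s₀ s₁ (hb.1.le.trans h₀) h₁ h₂ ?_)
        (ih hb.1.le (fun s₀ s₁ h₀ h₁ h₂ hB => step s₀ s₁ h₀ h₁ (h₂.trans hb.2.le) ?_) h0)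
      · exact List.forall_mem_cons.2 ⟨fun hs => hs.1.not_ge h₀, hB⟩
      · exact List.forall_mem_cons.2 ⟨fun hs => hs.2.not_ge h₂, hB⟩
    · refine ih h fun s₀ s₁ h₀ h₁ h₂ hB => step s₀ s₁ h₀ h₁ h₂ (List.forall_mem_cons.2 ⟨?_, hB⟩)
      exact fun hs => hb ⟨h₀.trans_lt hs.1, hs.2.trans_le h₂⟩

/-- A closed interval of times is either disjoint from the interior of `[t₀, t₁]` or contains
`[t₀, t₁]`, if its endpoints do not lie strictly between `t₀` and `t₁`. -/
theorem TimeInterval.Icc_subset_toSet {σ : ParamSig} {A : Interp σ} (I : TimeInterval σ)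
    {t₀ t₁ t : ℝ} (hI : ∀ c ∈ I.lo.toList ++ I.hi.toList, A.coef c ∉ Set.Ioo t₀ t₁)
    (ht : t ∈ Set.Ioo t₀ t₁) (h : t ∈ I.toSet A) : Set.Icc t₀ t₁ ⊆ I.toSet A := by
  simp only [List.mem_append, Option.mem_toList, Set.mem_Ioo, not_and, not_lt] at hI
  refine fun s hs => ⟨fun c hc => ?_, fun c hc => ?_⟩
  · by_contra! hlt
    have h1 := hI c (.inl hc) (hs.1.trans_lt hlt)
    linarith [h.1 c hc, ht.2]
  · by_contra! hlt
    have h1 := mt (hI c (.inr hc)) (not_le.2 (hlt.trans_le hs.2))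
    linarith [h.2 c hc, ht.1]

/-- The mean value theorem for linear combinations of the coordinates. -/
theorem sum_mul_sub_le_of_hasDerivAt {n : ℕ} {x : ℝ → Fin n → ℝ} {t₀ t₁ b : ℝ} (h : t₀ < t₁)
    (a : Fin n → ℝ) (hc : ContinuousOn x (Set.Icc t₀ t₁))
    (hd : ∀ t ∈ Set.Ioo t₀ t₁, ∃ v : Fin n → ℝ, HasDerivAt x v t ∧ ∑ i, a i * v i ≤ b) :
    ∑ i, a i * (x t₁ i - x t₀ i) ≤ b * (t₁ - t₀) := by
  choose! v hv hb using hd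
  -- The mean value theorem is applied to the scalar combination: the separate coordinates need not
  -- share an intermediate time.
  obtain ⟨c, hc, he⟩ := exists_hasDerivAt_eq_slope (fun t => ∑ i, a i * x t i)
    (fun t => ∑ i, a i * v t i) h
    (continuousOn_finsetSum _ fun i _ => continuousOn_const.mul (continuousOn_pi.1 hc i))
    (fun t ht => HasDerivAt.fun_sum fun i _ => (hasDerivAt_pi.1 (hv t ht) i).const_mul (a i))
  have hle := hb c hc
  rw [he, div_le_iff₀ (sub_pos.2 h)] at hle
  simpa [mul_sub, Finset.sum_sub_distrib] using hle

/-- A strict or non-strict bound at both ends of a segment holds along the segment if it is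
concave (an upper bound) or convex (a lower bound). -/
theorem StateIneq.holds_segment {σ : ParamSig} {n : ℕ} {A : Interp σ} {c : StateIneq σ n}
    (hshape : c.BoundShape A) {t₀ t₁ α β : ℝ} {x₀ x₁ : Fin n → ℝ} (h0 : c.Holds A t₀ x₀)
    (h1 : c.Holds A t₁ x₁) (ht₀ : t₀ ∈ c.interval.toSet A) (ht₁ : t₁ ∈ c.interval.toSet A)
    (hα : 0 ≤ α) (hβ : 0 ≤ β) (hαβ : α + β = 1) :
    c.Holds A (α * t₀ + β * t₁) (fun i => α * x₀ i + β * x₁ i) := by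
  intro _
  have hsum : ∑ i, A.coef (c.coeff i) * (α * x₀ i + β * x₁ i) =
      α * ∑ i, A.coef (c.coeff i) * x₀ i + β * ∑ i, A.coef (c.coeff i) * x₁ i := by
    simp only [Finset.mul_sum, ← Finset.sum_add_distrib]
    exact Finset.sum_congr rfl fun i _ => by ring
  replace h0 := h0 ht₀
  replace h1 := h1 ht₁
  rw [hsum]
  generalize ∑ i, A.coef (c.coeff i) * x₀ i = y₀ at *
  generalize ∑ i, A.coef (c.coeff i) * x₁ i = y₁ at *
  -- As the weights sum to 1, one of them is positive and keeps its inequality strict.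
  have strict : ∀ {p q r s : ℝ}, p < q → r < s → α * p + β * r < α * q + β * s := by
    intro p q r s hp hr
    rcases hα.eq_or_lt with rfl | hα
    · have : β = 1 := by linarith
      simpa [this] using hr
    · exact add_lt_add_of_lt_of_le (mul_lt_mul_of_pos_left hp hα)
        (mul_le_mul_of_nonneg_left hr.le hβ)
  have weak : ∀ {p q r s : ℝ}, p ≤ q → r ≤ s → α * p + β * r ≤ α * q + β * s := fun hp hr =>
    add_le_add (mul_le_mul_of_nonneg_left hp hα) (mul_le_mul_of_nonneg_left hr hβ)
  unfold BoundShape at hshape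
  generalize c.rel = r at *
  cases r with
  | le => exact (weak h0 h1).trans (hshape.2 ht₀ ht₁ hα hβ hαβ)
  | lt => exact (strict h0 h1).trans_le (hshape.2 ht₀ ht₁ hα hβ hαβ)
  | ge => exact (hshape.2 ht₀ ht₁ hα hβ hαβ).trans (weak h0 h1)
  | gt => exact (hshape.2 ht₀ ht₁ hα hβ hαβ).trans_lt (strict h0 h1)

/-! ### Soundness and weakestness of the clauses -/

namespace PLHA

variable {σ : ParamSig} {n : ℕ} {S : PLHA σ n} {A : Interp σ} {Φ : ConvexPred σ n}

/-- The flow is cut at the breakpoints. On each piece the mean value theorem supplies the averaged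
flow condition, and the mode invariant holds at both ends. Convexity plays no role in this
direction. -/
theorem holds_of_isFlow {q : Fin S.numModes} (hΓ : ClauseSet.Holds A ((S.mode q).flowClauses Φ))
    {t₀ t₁ : ℝ} {x : ℝ → Fin n → ℝ} (h0 : 0 ≤ t₀) (h : t₀ ≤ t₁)
    (hx : (S.interpret A).IsFlow q t₀ t₁ x) : Φ.Holds A t₀ (x t₀) → Φ.Holds A t₁ (x t₁) := by
  rw [PMode.holds_flowClauses] at hΓ
  refine preserved_of_forall_breakpoints (p := fun t => Φ.Holds A t (x t))
    ((S.mode q).breakpoints.map A.coef) h fun s₀ s₁ h₀ h₁ h₂ hB => ?_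
  refine hΓ s₀ s₁ (x s₀) (x s₁) (h0.trans h₀) h₁ (fun b hb => hB _ (List.mem_map_of_mem hb))
    (fun c hc hI => ?_) (hx.2.1 _ ⟨h₀, h₁.le.trans h₂⟩) (hx.2.1 _ ⟨h₀.trans h₁.le, h₂⟩)
  refine sum_mul_sub_le_of_hasDerivAt h₁ _ (hx.1.mono (Set.Icc_subset_Icc h₀ h₂)) fun t ht => ?_
  obtain ⟨v, hv, hf⟩ := hx.2.2 t (Set.Ioo_subset_Ioo h₀ h₂ ht)
  exact ⟨v, hv, hf c hc (hI (Set.Ioo_subset_Icc_self ht))⟩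

/-- The motion along a segment is a flow, if the convexity conditions are satisfied. -/
theorem isFlow_segment {q : Fin S.numModes}
    (hshape : ∀ c ∈ (S.mode q).inv, StateIneq.BoundShape A c) {t₀ t₁ : ℝ} {x₀ x₁ : Fin n → ℝ}
    (h : t₀ < t₁) (hB : ∀ b ∈ (S.mode q).breakpoints, A.coef b ∉ Set.Ioo t₀ t₁)
    (hflow : ∀ c ∈ (S.mode q).flow, Set.Icc t₀ t₁ ⊆ c.interval.toSet A →
      ∑ i, A.coef (c.coeff i) * (x₁ i - x₀ i) ≤ A.coef c.bound * (t₁ - t₀))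
    (h0 : (S.mode q).inv.Holds A t₀ x₀) (h1 : (S.mode q).inv.Holds A t₁ x₁) :
    (S.interpret A).IsFlow q t₀ t₁ (AffineMap.lineMap x₀ x₁ ∘ fun t => (t - t₀) / (t₁ - t₀)) := by
  have hpos : 0 < t₁ - t₀ := sub_pos.2 h
  have hB' : ∀ I : TimeInterval σ, ((∃ c ∈ (S.mode q).flow, c.interval = I) ∨
      ∃ c ∈ (S.mode q).inv, c.interval = I) →
      ∀ c ∈ I.lo.toList ++ I.hi.toList, A.coef c ∉ Set.Ioo t₀ t₁ := by
    intro I hI c hc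
    refine hB c ?_
    rw [PMode.breakpoints, List.mem_append, List.mem_flatMap, List.mem_flatMap]
    exact hI.imp (fun ⟨d, hd, e⟩ => ⟨d, hd, e ▸ hc⟩) (fun ⟨d, hd, e⟩ => ⟨d, hd, e ▸ hc⟩)
  have hderiv : ∀ t, HasDerivAt (AffineMap.lineMap x₀ x₁ ∘ fun t => (t - t₀) / (t₁ - t₀))
      ((t₁ - t₀)⁻¹ • (x₁ - x₀)) t := by
    intro t
    have hd := ((hasDerivAt_id t).sub_const t₀).div_const (t₁ - t₀)
    rw [one_div] at hd
    exact AffineMap.hasDerivAt_lineMap.scomp t hd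
  refine ⟨fun t _ => (hderiv t).continuousAt.continuousWithinAt, fun t ht c hc => ?_,
    fun t ht => ⟨_, hderiv t, fun c hc hI => ?_⟩⟩
  · have hx : (AffineMap.lineMap x₀ x₁ ∘ fun t => (t - t₀) / (t₁ - t₀)) t =
        fun i => (t₁ - t) / (t₁ - t₀) * x₀ i + (t - t₀) / (t₁ - t₀) * x₁ i := by
      funext i
      simp only [Function.comp, AffineMap.lineMap_apply_module, Pi.add_apply, Pi.smul_apply,
        smul_eq_mul]
      congr 2
      field_simp
      ring
    rw [hx]
    -- The endpoints are treated apart, since the interval of a constraint may meet `[t₀, t₁]` in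
    -- one endpoint only. A constraint in force at an interior time is in force throughout, so
    -- convexity applies.
    rcases ht.1.eq_or_lt with rfl | ht₀
    · simpa [hpos.ne'] using h0 c hc
    rcases ht.2.eq_or_lt with rfl | ht₁
    · simpa [hpos.ne'] using h1 c hc
    intro hI
    have hsub := c.interval.Icc_subset_toSet (hB' _ (.inr ⟨c, hc, rfl⟩)) ⟨ht₀, ht₁⟩ hI
    have hseg := StateIneq.holds_segment (hshape c hc) (h0 c hc) (h1 c hc)
      (hsub ⟨le_rfl, h.le⟩) (hsub ⟨h.le, le_rfl⟩)
      (div_nonneg (sub_nonneg.2 ht.2) hpos.le) (div_nonneg (sub_nonneg.2 ht.1) hpos.le)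
      (by field_simp; ring)
    have ht' : (t₁ - t) / (t₁ - t₀) * t₀ + (t - t₀) / (t₁ - t₀) * t₁ = t := by
      field_simp; ring
    rw [ht'] at hseg
    exact hseg hI
  -- The velocity is constant and equals the average velocity, so the averaged condition is the flow
  -- condition itself.
  · have hle := hflow c hc (c.interval.Icc_subset_toSet (hB' _ (.inl ⟨c, hc, rfl⟩)) ht hI)
    have hsum : ∑ i, A.coef (c.coeff i) * ((t₁ - t₀)⁻¹ • (x₁ - x₀)) i =
        (∑ i, A.coef (c.coeff i) * (x₁ i - x₀ i)) / (t₁ - t₀) := by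
      rw [Finset.sum_div]
      exact Finset.sum_congr rfl fun i _ => by
        simp only [Pi.smul_apply, Pi.sub_apply, smul_eq_mul]; ring
    rw [hsum, div_le_iff₀ hpos]
    exact hle

theorem isInvariant_of_holds (hΓ : ClauseSet.Holds A (S.invariantClauses Φ)) :
    (S.interpret A).IsInvariant (ConvexPred.Holds A Φ) := by
  rw [holds_invariantClauses] at hΓ
  refine ⟨fun q t a h0 ha => PMode.holds_initialClauses _ _ |>.1 (hΓ.1 q) t a h0 ha,
    fun q t₀ t₁ x h0 h hx => holds_of_isFlow (hΓ.2.1 q) h0 h hx, fun e t a a' h0 hj hΦ => ?_⟩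
  exact (PSwitch.holds_clauses _ _ _).1 (hΓ.2.2 _ (List.get_mem _ e)) t a a' h0 hj.1 hj.2.1
    hj.2.2.1 hj.2.2.2 hΦ

/-- Segments serve as test flows: a pair of states that meets the premises of the flow clauses is
joined by one, to which invariance applies. -/
theorem holds_of_isInvariant (hshape : S.BoundShape A)
    (hinv : (S.interpret A).IsInvariant (ConvexPred.Holds A Φ)) :
    ClauseSet.Holds A (S.invariantClauses Φ) := by
  rw [holds_invariantClauses]
  refine ⟨fun q => (PMode.holds_initialClauses _ _).2 (hinv.1 q),
    fun q => (PMode.holds_flowClauses _ _).2 ?_, fun e he => (PSwitch.holds_clauses _ _ _).2 ?_⟩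
  · intro t₀ t₁ x₀ x₁ h0 h hB hflow hi₀ hi₁ hΦ
    have key := hinv.2.1 q t₀ t₁ _ h0 h.le
      (isFlow_segment (hshape.1 q).1 h hB hflow hi₀ hi₁)
    simpa [hΦ, (sub_pos.2 h).ne'] using key
  · obtain ⟨i, rfl⟩ := List.get_of_mem he
    intro t x x' h0 hi hg hj hi' hΦ
    exact hinv.2.2 i t x x' h0 ⟨hi, hg, hj, hi'⟩ hΦ

end PLHA

/-! ### Operations on codes -/

theorem termCode_var {σ : ParamSig} {α : Type} (idx : α → ℕ) (a : α) :
    termCode (σ := σ) idx (.var a) = [(6, (idx a : ℤ), 0)] := rfl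

theorem termCode_func {σ : ParamSig} {α : Type} (idx : α → ℕ) {k : ℕ} (f : ParamFunc σ k)
    (ts : Fin k → (paramLang σ).Term α) :
    termCode idx (Language.Term.func (L := paramLang σ) f ts) =
      f.token :: (List.finRange k).flatMap fun i => termCode idx (ts i) := by
  simp [termCode, Language.Term.listEncode, List.map_flatMap]

/-- The tag 6 is reserved for variables, so substitution on codes leaves function symbols alone. -/
theorem ParamFunc.token_ne {σ : ParamSig} {k : ℕ} (f : ParamFunc σ k) : f.token.1 ≠ 6 := by
  cases f <;> simp [token]

/-- The code of a term in Polish notation. -/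
abbrev TermCode : Type := List Token

namespace TermCode

def zero : TermCode := [(0, 0, 1)]

def add (s t : TermCode) : TermCode := (1, 0, 0) :: (s ++ t)

def mul (s t : TermCode) : TermCode := (2, 0, 0) :: (s ++ t)

def neg (s : TermCode) : TermCode := (3, 0, 0) :: s

def var (i : ℕ) : TermCode := [(6, (i : ℤ), 0)]

/-- Polish notation has no brackets, so substitution is replacement token by token. Every variable
token of a time term stands for the time. -/
def atTime (τ b : TermCode) : TermCode := b.flatMap fun a => if a.1 = 6 then τ else [a]

/-- In Polish notation a sum nested to the right is flat: each summand is preceded by a plus token,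
and the final 0 closes the list. The index stays within the list, so the default `[]` is never used.
-/
def lin (a : List TermCode) (k : ℕ) : TermCode :=
  ((List.range a.length).flatMap fun i => (1, 0, 0) :: mul (a.getD i []) (var (2 * i + k))) ++ zero

end TermCode

section TermCode

variable {σ : ParamSig}

theorem termCode_num_zero : termCode id (ParamTerm.num 0 : (paramLang σ).Term ℕ) = TermCode.zero := by
  simp [ParamTerm.num, termCode_func, ParamFunc.token, TermCode.zero]

theorem termCode_add (s t : (paramLang σ).Term ℕ) :
    termCode id (ParamTerm.add s t) = TermCode.add (termCode id s) (termCode id t) := by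
  simp [ParamTerm.add, termCode_func, ParamFunc.token, TermCode.add, List.finRange_succ]

theorem termCode_mul (s t : (paramLang σ).Term ℕ) :
    termCode id (ParamTerm.mul s t) = TermCode.mul (termCode id s) (termCode id t) := by
  simp [ParamTerm.mul, termCode_func, ParamFunc.token, TermCode.mul, List.finRange_succ]

theorem termCode_neg (s : (paramLang σ).Term ℕ) :
    termCode id (ParamTerm.neg s) = TermCode.neg (termCode id s) := by
  simp [ParamTerm.neg, termCode_func, ParamFunc.token, TermCode.neg, List.finRange_succ]

theorem termCode_id_var (i : ℕ) :
    termCode id (.var i : (paramLang σ).Term ℕ) = TermCode.var i := rfl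

theorem termCode_ofCoef (c : Coef σ) : termCode id (ParamTerm.ofCoef c) = c.code := by
  rw [ParamTerm.ofCoef, Coef.code]
  induction c with
  | var e => exact e.elim
  | func f ts ih =>
    rw [Language.Term.relabel, termCode_func, termCode_func]
    simp only [ih]

theorem termCode_atTime (τ : (paramLang σ).Term ℕ) (b : TimeTerm σ) :
    termCode id (ParamTerm.atTime τ b) = TermCode.atTime (termCode id τ) b.code := by
  rw [ParamTerm.atTime, TimeTerm.code]
  induction b with
  | var e => simp [Language.Term.subst, termCode_var, TermCode.atTime]
  | func f ts ih =>
    rw [Language.Term.subst, termCode_func, termCode_func]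
    have := ParamFunc.token_ne f
    simp [ih, TermCode.atTime, this, List.flatMap_assoc]

theorem termCode_lin {n : ℕ} (a : Fin n → Coef σ) (k : ℕ) :
    termCode id (ParamTerm.lin a k) = TermCode.lin (coeffCode a) k := by
  have h : ∀ l : List (Fin n), termCode id ((l.map fun i => ParamTerm.mul
      (ParamTerm.ofCoef (a i)) (.var (2 * (i : ℕ) + k))).foldr ParamTerm.add (ParamTerm.num 0)) =
      ((l.map Fin.val).flatMap fun i => (1, 0, 0) ::
        TermCode.mul ((coeffCode a).getD i []) (.var (2 * i + k))) ++ TermCode.zero := by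
    intro l
    induction l with
    | nil => exact termCode_num_zero
    | cons i l ih =>
      rw [List.map_cons, List.foldr_cons, termCode_add, ih]
      simp [termCode_mul, termCode_ofCoef, termCode_id_var, TermCode.add, coeffCode]
  rw [ParamTerm.lin, h, List.map_coe_finRange_eq_range, TermCode.lin]
  simp [coeffCode]

end TermCode

namespace LiteralCode

def neg (l : LiteralCode) : LiteralCode := (l.2.2, !l.2.1, l.1)

def le (s t : TermCode) : LiteralCode := (s, false, t)

def lt (s t : TermCode) : LiteralCode := (s, true, t)

/-- The literal that compares `s` and `t` by the relation with code `r`. -/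
def ofCmp (r : ℕ) (s t : TermCode) : LiteralCode :=
  if r = 0 then le s t else if r = 1 then lt s t else if r = 2 then le t s else lt t s

end LiteralCode

abbrev ClauseSetCode : Type := List (List LiteralCode)

def ClauseSetCode.implies (P Q : ClauseSetCode) : ClauseSetCode :=
  implicationClauses LiteralCode.neg P Q

namespace TimeIntervalCode

def outsideClause (I : TimeIntervalCode) (τ₀ τ₁ : TermCode) : List LiteralCode :=
  I.1.toList.map (fun c => LiteralCode.lt τ₀ c) ++ I.2.toList.map (fun c => LiteralCode.lt c τ₁)

def breakClauses (I : TimeIntervalCode) : ClauseSetCode :=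
  (I.1.toList ++ I.2.toList).map fun c =>
    [LiteralCode.le c (.var 0), LiteralCode.le (.var 1) c]

end TimeIntervalCode

def StateIneqCode.clause (τ : TermCode) (k : ℕ) (c : StateIneqCode) : List LiteralCode :=
  TimeIntervalCode.outsideClause c.2.2.2 τ τ ++
    [LiteralCode.ofCmp c.2.1 (.lin c.1 k) (.atTime τ c.2.2.1)]

def FlowIneqCode.clause (c : FlowIneqCode) : List LiteralCode :=
  TimeIntervalCode.outsideClause c.2.2 (.var 0) (.var 1) ++
    [LiteralCode.le (.lin c.1 3)
      (.add (.lin c.1 2) (.mul c.2.1 (.add (.var 1) (.neg (.var 0)))))]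

def JumpIneqCode.clause (c : JumpIneqCode) : List LiteralCode :=
  TimeIntervalCode.outsideClause c.2.2.2.2 (.var 0) (.var 0) ++
    [LiteralCode.ofCmp c.2.2.1 (.add (.lin c.1 2) (.lin c.2.1 3)) (.atTime (.var 0) c.2.2.2.1)]

/-- The code of a convex linear predicate. -/
abbrev ConvexPredCode : Type := List StateIneqCode

def ConvexPredCode.clauses (τ : TermCode) (k : ℕ) (P : ConvexPredCode) : ClauseSetCode :=
  P.map (StateIneqCode.clause τ k)

def nonnegClauseCode : List LiteralCode := [LiteralCode.le .zero (.var 0)]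

namespace PModeCode

def initialClauses (M : PModeCode) (Φ : ConvexPredCode) : ClauseSetCode :=
  ClauseSetCode.implies (nonnegClauseCode :: ConvexPredCode.clauses (.var 0) 2 M.2.2)
    (ConvexPredCode.clauses (.var 0) 2 Φ)

def breakClauses (M : PModeCode) : ClauseSetCode :=
  M.1.flatMap (fun c => TimeIntervalCode.breakClauses c.2.2) ++
    M.2.1.flatMap (fun c => TimeIntervalCode.breakClauses c.2.2.2)

def flowClauses (M : PModeCode) (Φ : ConvexPredCode) : ClauseSetCode :=
  ClauseSetCode.implies
    (nonnegClauseCode :: [LiteralCode.lt (.var 0) (.var 1)] ::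
      (breakClauses M ++ (M.1.map FlowIneqCode.clause ++
        (ConvexPredCode.clauses (.var 0) 2 M.2.1 ++ (ConvexPredCode.clauses (.var 1) 3 M.2.1 ++
          ConvexPredCode.clauses (.var 0) 2 Φ)))))
    (ConvexPredCode.clauses (.var 1) 3 Φ)

/-- The code of the invariant of the mode with number `q`. -/
def invAt (modes : List PModeCode) (q : ℕ) : ConvexPredCode := (modes.getD q ([], [], [])).2.1

end PModeCode

namespace PSwitchCode

def timeAfter (e : PSwitchCode) : TermCode := if e.2.2.2.2 = true then .zero else .var 0

def clauses (modes : List PModeCode) (e : PSwitchCode) (Φ : ConvexPredCode) : ClauseSetCode :=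
  ClauseSetCode.implies
    (nonnegClauseCode :: (ConvexPredCode.clauses (.var 0) 2 (PModeCode.invAt modes e.1) ++
      (ConvexPredCode.clauses (.var 0) 2 e.2.2.1 ++ (e.2.2.2.1.map JumpIneqCode.clause ++
        (ConvexPredCode.clauses (timeAfter e) 3 (PModeCode.invAt modes e.2.1) ++
          ConvexPredCode.clauses (.var 0) 2 Φ)))))
    (ConvexPredCode.clauses (timeAfter e) 3 Φ)

end PSwitchCode

/-- The algorithm: from the code of an automaton and a convex linear property to the code of the
weakest constraints on the parameters. -/
def PLHACode.invariantClauses (S : PLHACode) (Φ : ConvexPredCode) : ClauseSetCode :=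
  S.2.2.1.flatMap (fun M => PModeCode.initialClauses M Φ ++ PModeCode.flowClauses M Φ) ++
    S.2.2.2.flatMap (fun e => PSwitchCode.clauses S.2.2.1 e Φ)

/-! ### Coding commutes with the construction of clauses -/

section Correctness

variable {σ : ParamSig} {n : ℕ}

theorem Literal.code_neg (l : Literal σ) : l.neg.code = LiteralCode.neg l.code := rfl

theorem Literal.code_le (s t : (paramLang σ).Term ℕ) :
    (Literal.le s t).code = LiteralCode.le (termCode id s) (termCode id t) := rfl

theorem Literal.code_lt (s t : (paramLang σ).Term ℕ) :
    (Literal.lt s t).code = LiteralCode.lt (termCode id s) (termCode id t) := rfl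

theorem Literal.code_ofCmp (r : Cmp) (s t : (paramLang σ).Term ℕ) :
    (Literal.ofCmp r s t).code = LiteralCode.ofCmp r.code (termCode id s) (termCode id t) := by
  cases r <;> rfl

/-- The code of a clause. -/
def Clause.code (C : Clause σ) : List LiteralCode := C.map Literal.code

theorem ClauseSet.code_eq (Γ : ClauseSet σ) : Γ.code = Γ.map Clause.code := rfl

theorem ClauseSet.code_implies (P Q : ClauseSet σ) :
    (ClauseSet.implies P Q).code = ClauseSetCode.implies P.code Q.code :=
  implicationClauses_map Literal.code_neg P Q

theorem ClauseSet.code_cons (C : Clause σ) (Γ : ClauseSet σ) :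
    ClauseSet.code (C :: Γ) = C.code :: Γ.code := rfl

theorem ClauseSet.code_append (Γ Δ : ClauseSet σ) :
    ClauseSet.code (Γ ++ Δ) = Γ.code ++ Δ.code := List.map_append

theorem ClauseSet.code_map {β γ : Type} {f : β → Clause σ} {g : γ → List LiteralCode} {c : β → γ}
    (h : ∀ b, (f b).code = g (c b)) (l : List β) :
    ClauseSet.code (l.map f) = (l.map c).map g := by
  simp [ClauseSet.code_eq, h]

theorem ClauseSet.code_flatMap {β γ : Type} {f : β → ClauseSet σ} {g : γ → ClauseSetCode}
    {c : β → γ} (h : ∀ b, (f b).code = g (c b)) (l : List β) :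
    ClauseSet.code (l.flatMap f) = (l.map c).flatMap g := by
  simp only [ClauseSet.code_eq] at h
  simp [ClauseSet.code_eq, List.map_flatMap, List.flatMap_map, h]

theorem TimeInterval.code_outsideClause (I : TimeInterval σ) (τ₀ τ₁ : (paramLang σ).Term ℕ) :
    (I.outsideClause τ₀ τ₁).code =
      TimeIntervalCode.outsideClause I.code (termCode id τ₀) (termCode id τ₁) := by
  rcases I with ⟨_ | a, _ | b⟩ <;>
    simp [outsideClause, Clause.code, TimeIntervalCode.outsideClause, TimeInterval.code,
      Literal.code_lt, termCode_ofCoef]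

theorem TimeInterval.code_breakClauses (I : TimeInterval σ) :
    I.breakClauses.code = TimeIntervalCode.breakClauses I.code := by
  rcases I with ⟨_ | a, _ | b⟩ <;>
    simp [breakClauses, ClauseSet.code, TimeIntervalCode.breakClauses, TimeInterval.code,
      Literal.code_le, termCode_ofCoef, termCode_id_var]

theorem StateIneq.code_clause (τ : (paramLang σ).Term ℕ) (k : ℕ) (c : StateIneq σ n) :
    (c.clause τ k).code = StateIneqCode.clause (termCode id τ) k c.code := by
  rw [clause, Clause.code, List.map_append, ← Clause.code, TimeInterval.code_outsideClause,
    List.map_singleton, Literal.code_ofCmp, termCode_lin, termCode_atTime]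
  rfl

theorem FlowIneq.code_clause (c : FlowIneq σ n) : c.clause.code = FlowIneqCode.clause c.code := by
  rw [clause, Clause.code, List.map_append, ← Clause.code, TimeInterval.code_outsideClause,
    List.map_singleton, Literal.code_le]
  simp only [termCode_lin, termCode_add, termCode_mul, termCode_neg, termCode_ofCoef]
  rfl

theorem JumpIneq.code_clause (c : JumpIneq σ n) : c.clause.code = JumpIneqCode.clause c.code := by
  rw [clause, Clause.code, List.map_append, ← Clause.code, TimeInterval.code_outsideClause,
    List.map_singleton, Literal.code_ofCmp, termCode_add, termCode_lin, termCode_lin,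
    termCode_atTime]
  rfl

theorem ConvexPred.code_clauses (τ : (paramLang σ).Term ℕ) (k : ℕ) (P : ConvexPred σ n) :
    ClauseSet.code (P.clauses τ k) = ConvexPredCode.clauses (termCode id τ) k P.code :=
  ClauseSet.code_map (StateIneq.code_clause τ k) P

theorem code_nonnegClause : Clause.code (nonnegClause (σ := σ)) = nonnegClauseCode := by
  simp [nonnegClause, Clause.code, Literal.code_le, termCode_num_zero, termCode_id_var,
    nonnegClauseCode]

theorem PMode.code_initialClauses (M : PMode σ n) (Φ : ConvexPred σ n) :
    (M.initialClauses Φ).code = PModeCode.initialClauses M.code Φ.code := by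
  simp only [initialClauses, ClauseSet.code_implies, ClauseSet.code_cons, code_nonnegClause,
    ConvexPred.code_clauses]
  rfl

theorem PMode.code_breakClauses (M : PMode σ n) :
    M.breakClauses.code = PModeCode.breakClauses M.code := by
  rw [breakClauses, ClauseSet.code_append,
    ClauseSet.code_flatMap (g := fun c => TimeIntervalCode.breakClauses c.2.2)
      (c := FlowIneq.code) fun c => c.interval.code_breakClauses,
    ClauseSet.code_flatMap (g := fun c => TimeIntervalCode.breakClauses c.2.2.2)
      (c := StateIneq.code) fun c => c.interval.code_breakClauses]
  rfl

theorem PMode.code_flowClauses (M : PMode σ n) (Φ : ConvexPred σ n) :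
    (M.flowClauses Φ).code = PModeCode.flowClauses M.code Φ.code := by
  simp only [flowClauses, ClauseSet.code_implies, ClauseSet.code_cons, code_nonnegClause,
    ConvexPred.code_clauses, ClauseSet.code_append, PMode.code_breakClauses,
    ClauseSet.code_map FlowIneq.code_clause]
  rfl

theorem PSwitch.code_clauses {m : ℕ} (mode : Fin m → PMode σ n) (e : PSwitch σ n m)
    (Φ : ConvexPred σ n) : (e.clauses mode Φ).code =
      PSwitchCode.clauses (List.ofFn fun q => (mode q).code) e.code Φ.code := by
  -- The index of a mode is in range, so the default mode in the lookup does not intervene.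
  have hinv : ∀ q : Fin m, PModeCode.invAt (List.ofFn fun q => (mode q).code) q =
      (mode q).inv.code := by
    intro q
    simp [PModeCode.invAt, PMode.code]
  have hτ : termCode id e.timeAfter = PSwitchCode.timeAfter e.code := by
    rw [PSwitch.timeAfter, PSwitchCode.timeAfter, apply_ite (termCode id), termCode_num_zero]
    rfl
  simp only [clauses, ClauseSet.code_implies, ClauseSet.code_cons, code_nonnegClause,
    ConvexPred.code_clauses, ClauseSet.code_append, ClauseSet.code_map JumpIneq.code_clause, hτ,
    ← hinv]
  rfl

theorem PLHA.code_invariantClauses (S : PLHA σ n) (Φ : ConvexPred σ n) :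
    (S.invariantClauses Φ).code = PLHACode.invariantClauses S.code Φ.code := by
  rw [invariantClauses, ClauseSet.code_append,
    ClauseSet.code_flatMap (c := PMode.code) (g := fun M =>
      PModeCode.initialClauses M Φ.code ++ PModeCode.flowClauses M Φ.code) fun M => by
        rw [ClauseSet.code_append, PMode.code_initialClauses, PMode.code_flowClauses],
    ClauseSet.code_flatMap (c := PSwitch.code) (g := fun e => PSwitchCode.clauses
      (List.ofFn fun q => (S.mode q).code) e Φ.code) fun e => e.code_clauses S.mode Φ,
    List.map_ofFn]
  rfl

end Correctness

/-! ### Computability -/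

section Computability

open Primrec

variable {α β : Type} [Primcodable α] [Primcodable β]

/-- The encoding of the integers sends a natural number `n` to `2 * n`. -/
theorem Primrec.intCast : Primrec fun n : ℕ => (n : ℤ) := by
  rw [← Primrec.encode_iff]
  exact Primrec.nat_double.of_eq fun n => rfl

/-- The recursion is a right fold that starts from the single empty section and prepends each
element of the next list to all sections found so far. -/
theorem Primrec.list_sections : Primrec (List.sections : List (List α) → List (List α)) := by
  have h : Primrec₂ fun (_ : List (List α)) (p : List α × List (List α)) =>
      p.2.flatMap fun s => p.1.map fun a => a :: s :=
    list_flatMap (snd.comp snd) <| list_map (fst.comp (snd.comp fst)) <|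
      list_cons.comp snd (snd.comp fst)
  refine (list_foldr .id (const [([] : List α)]) h).of_eq fun L => ?_
  induction L with
  | nil => rfl
  | cons C L ih => simpa [List.sections] using congrArg _ ih

theorem Primrec.implicationClauses {neg : α → α} (h : Primrec neg) :
    Primrec₂ (_root_.implicationClauses neg) :=
  list_flatMap (list_sections.comp fst) <| list_map (snd.comp fst) <|
    list_append.comp (list_map (snd.comp fst) (h.comp snd)) snd

theorem Primrec.option_toList : Primrec (Option.toList : Option α → List α) :=
  (option_casesOn .id (const []) (list_cons.comp snd (const [])).to₂).of_eq fun o => by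
    cases o <;> rfl

namespace TermCode

variable {f g : α → TermCode}

theorem primrec_add (hf : Primrec f) (hg : Primrec g) : Primrec fun a => add (f a) (g a) :=
  list_cons.comp (const _) (list_append.comp hf hg)

theorem primrec_mul (hf : Primrec f) (hg : Primrec g) : Primrec fun a => mul (f a) (g a) :=
  list_cons.comp (const _) (list_append.comp hf hg)

theorem primrec_var : Primrec var :=
  list_cons.comp ((const 6).pair (intCast.pair (const 0))) (const [])

theorem primrec_atTime : Primrec₂ atTime :=
  list_flatMap snd <| Primrec.ite (Primrec.eq.comp (fst.comp snd) (const 6)) (fst.comp fst)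
    (list_cons.comp snd (const []))

theorem primrec_lin : Primrec₂ lin :=
  list_append.comp
    (list_flatMap (list_range.comp (list_length.comp fst)) <| list_cons.comp (const _) <|
      primrec_mul ((list_getD []).comp (fst.comp fst) snd)
        (primrec_var.comp (nat_add.comp (nat_mul.comp (const 2) snd) (snd.comp fst))))
    (const _)

end TermCode

namespace LiteralCode

theorem primrec_neg : Primrec neg :=
  (snd.comp snd).pair ((Primrec.not.comp (fst.comp snd)).pair fst)

theorem primrec_le : Primrec₂ le := fst.pair ((const false).pair snd)

theorem primrec_lt : Primrec₂ lt := fst.pair ((const true).pair snd)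

theorem primrec_ofCmp {r : α → ℕ} {f g : α → TermCode} (hr : Primrec r) (hf : Primrec f)
    (hg : Primrec g) : Primrec fun a => ofCmp (r a) (f a) (g a) :=
  .ite (Primrec.eq.comp hr (const 0)) (primrec_le.comp hf hg) <|
    .ite (Primrec.eq.comp hr (const 1)) (primrec_lt.comp hf hg) <|
      .ite (Primrec.eq.comp hr (const 2)) (primrec_le.comp hg hf) (primrec_lt.comp hg hf)

end LiteralCode

theorem Primrec.list_singleton {f : α → β} (hf : Primrec f) : Primrec fun a => [f a] :=
  list_cons.comp hf (const [])

theorem ClauseSetCode.primrec_implies : Primrec₂ ClauseSetCode.implies :=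
  Primrec.implicationClauses LiteralCode.primrec_neg

theorem TimeIntervalCode.primrec_outsideClause {I : α → TimeIntervalCode} {f g : α → TermCode}
    (hI : Primrec I) (hf : Primrec f) (hg : Primrec g) :
    Primrec fun a => outsideClause (I a) (f a) (g a) :=
  list_append.comp
    (list_map (option_toList.comp (fst.comp hI)) (LiteralCode.primrec_lt.comp (hf.comp fst) snd))
    (list_map (option_toList.comp (snd.comp hI)) (LiteralCode.primrec_lt.comp snd (hg.comp fst)))

theorem TimeIntervalCode.primrec_breakClauses : Primrec breakClauses :=
  list_map (list_append.comp (option_toList.comp fst) (option_toList.comp snd)) <|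
    list_cons.comp (LiteralCode.primrec_le.comp snd (const _))
      (list_singleton (LiteralCode.primrec_le.comp (const _) snd))

theorem StateIneqCode.primrec_clause (k : ℕ) :
    Primrec₂ fun (τ : TermCode) (c : StateIneqCode) => StateIneqCode.clause τ k c :=
  list_append.comp
    (TimeIntervalCode.primrec_outsideClause (snd.comp (snd.comp (snd.comp snd))) fst fst)
    (list_singleton (LiteralCode.primrec_ofCmp (fst.comp (snd.comp snd))
      (TermCode.primrec_lin.comp (fst.comp snd) (const k))
      (TermCode.primrec_atTime.comp fst (fst.comp (snd.comp (snd.comp snd))))))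

theorem FlowIneqCode.primrec_clause : Primrec FlowIneqCode.clause :=
  list_append.comp
    (TimeIntervalCode.primrec_outsideClause (snd.comp snd) (const _) (const _))
    (list_singleton (LiteralCode.primrec_le.comp (TermCode.primrec_lin.comp fst (const 3))
      (TermCode.primrec_add (TermCode.primrec_lin.comp fst (const 2))
        (TermCode.primrec_mul (fst.comp snd) (const _)))))

theorem JumpIneqCode.primrec_clause : Primrec JumpIneqCode.clause :=
  list_append.comp
    (TimeIntervalCode.primrec_outsideClause (snd.comp (snd.comp (snd.comp snd))) (const _)
      (const _))
    (list_singleton (LiteralCode.primrec_ofCmp (fst.comp (snd.comp snd))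
      (TermCode.primrec_add (TermCode.primrec_lin.comp fst (const 2))
        (TermCode.primrec_lin.comp (fst.comp snd) (const 3)))
      (TermCode.primrec_atTime.comp (const _) (fst.comp (snd.comp (snd.comp snd))))))

theorem ConvexPredCode.primrec_clauses (k : ℕ) {τ : α → TermCode} {P : α → ConvexPredCode}
    (hτ : Primrec τ) (hP : Primrec P) : Primrec fun a => clauses (τ a) k (P a) :=
  list_map hP ((StateIneqCode.primrec_clause k).comp (hτ.comp fst) snd)

theorem PModeCode.primrec_initialClauses : Primrec₂ initialClauses :=
  ClauseSetCode.primrec_implies.comp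
    (list_cons.comp (const _)
      (ConvexPredCode.primrec_clauses 2 (const _) (snd.comp (snd.comp fst))))
    (ConvexPredCode.primrec_clauses 2 (const _) snd)

theorem PModeCode.primrec_breakClauses : Primrec breakClauses :=
  list_append.comp
    (list_flatMap fst (TimeIntervalCode.primrec_breakClauses.comp (snd.comp (snd.comp snd))))
    (list_flatMap (fst.comp snd)
      (TimeIntervalCode.primrec_breakClauses.comp (snd.comp (snd.comp (snd.comp snd)))))

theorem PModeCode.primrec_flowClauses : Primrec₂ flowClauses :=
  ClauseSetCode.primrec_implies.comp
    (list_cons.comp (const _) <| list_cons.comp (const _) <|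
      list_append.comp (primrec_breakClauses.comp fst) <|
      list_append.comp (list_map (fst.comp fst) (FlowIneqCode.primrec_clause.comp snd)) <|
      list_append.comp
        (ConvexPredCode.primrec_clauses 2 (const _) (fst.comp (snd.comp fst))) <|
      list_append.comp
        (ConvexPredCode.primrec_clauses 3 (const _) (fst.comp (snd.comp fst)))
        (ConvexPredCode.primrec_clauses 2 (const _) snd))
    (ConvexPredCode.primrec_clauses 3 (const _) snd)

theorem PModeCode.primrec_invAt : Primrec₂ invAt :=
  (fst.comp snd).comp (list_getD ([], [], []))

theorem PSwitchCode.primrec_timeAfter : Primrec timeAfter :=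
  .ite (Primrec.eq.comp (snd.comp (snd.comp (snd.comp snd))) (const true)) (const _) (const _)

theorem PSwitchCode.primrec_clauses :
    Primrec fun p : (List PModeCode × PSwitchCode) × ConvexPredCode =>
      clauses p.1.1 p.1.2 p.2 := by
  have hm : Primrec fun p : (List PModeCode × PSwitchCode) × ConvexPredCode => p.1.1 :=
    fst.comp fst
  have he : Primrec fun p : (List PModeCode × PSwitchCode) × ConvexPredCode => p.1.2 :=
    snd.comp fst
  exact ClauseSetCode.primrec_implies.comp
    (list_cons.comp (const _) <|
      list_append.comp (ConvexPredCode.primrec_clauses 2 (const _)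
        (PModeCode.primrec_invAt.comp hm (fst.comp he))) <|
      list_append.comp (ConvexPredCode.primrec_clauses 2 (const _)
        (fst.comp (snd.comp (snd.comp he)))) <|
      list_append.comp (list_map (fst.comp (snd.comp (snd.comp (snd.comp he))))
        (JumpIneqCode.primrec_clause.comp snd)) <|
      list_append.comp (ConvexPredCode.primrec_clauses 3 (primrec_timeAfter.comp he)
        (PModeCode.primrec_invAt.comp hm (fst.comp (snd.comp he))))
        (ConvexPredCode.primrec_clauses 2 (const _) snd))
    (ConvexPredCode.primrec_clauses 3 (primrec_timeAfter.comp he) snd)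

theorem PLHACode.primrec_invariantClauses : Primrec₂ invariantClauses := by
  have hm : Primrec fun p : PLHACode × ConvexPredCode => p.1.2.2.1 :=
    fst.comp (snd.comp (snd.comp fst))
  have hs : Primrec fun p : PLHACode × ConvexPredCode => p.1.2.2.2 :=
    snd.comp (snd.comp (snd.comp fst))
  have h₁ : Primrec fun p : PLHACode × ConvexPredCode => p.1.2.2.1.flatMap fun M =>
      PModeCode.initialClauses M p.2 ++ PModeCode.flowClauses M p.2 :=
    list_flatMap hm (list_append.comp
      (PModeCode.primrec_initialClauses.comp snd (snd.comp fst))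
      (PModeCode.primrec_flowClauses.comp snd (snd.comp fst))).to₂
  have h₂ : Primrec fun p : PLHACode × ConvexPredCode => p.1.2.2.2.flatMap fun e =>
      PSwitchCode.clauses p.1.2.2.1 e p.2 :=
    list_flatMap hs
      (PSwitchCode.primrec_clauses.comp (((hm.comp fst).pair snd).pair (snd.comp fst))).to₂
  exact list_append.comp h₁ h₂

end Computability

/-- There is an algorithm `derive` which computes, from a PLHA `S` and a convex linear property `Φ`
(both possibly with parameters), universally quantified constraints `Γ` on the parameters such that
`Φ` is an invariant in every interpretation in which `Γ` holds; and `Γ` is the weakest such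
constraint in the interpretations that satisfy the convexity/concavity conditions of `S`. -/
theorem mainTheorem5 :
    ∃ derive : PLHACode × List StateIneqCode → List (List LiteralCode),
      Computable derive ∧
      ∀ (σ : ParamSig) (n : ℕ) (S : PLHA σ n) (Φ : ConvexPred σ n),
        ∃ Γ : ClauseSet σ,
          derive (S.code, ConvexPred.code Φ) = ClauseSet.code Γ ∧
          (∀ A : Interp σ, ClauseSet.Holds A Γ →
            (S.interpret A).IsInvariant (ConvexPred.Holds A Φ)) ∧
          (∀ A : Interp σ, S.BoundShape A →
            (S.interpret A).IsInvariant (ConvexPred.Holds A Φ) → ClauseSet.Holds A Γ) :=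
  ⟨fun p => PLHACode.invariantClauses p.1 p.2, Primrec.to_comp PLHACode.primrec_invariantClauses,
    fun _ _ S Φ => ⟨S.invariantClauses Φ, (S.code_invariantClauses Φ).symm,
      fun _ => PLHA.isInvariant_of_holds, fun _ => PLHA.holds_of_isInvariant⟩⟩
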